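/- Let $K$ be a field, let $\mathbb{S}_n$ be the $K$-algebra generated by $x_1,\dots,x_n,y_1,\dots,y_n$ subject to the relations $y_ix_i=1$ for all $i$ and $[x_i,x_j]=[x_i,y_j]=[y_i,y_j]=0$ for all $i\neq j$, and let $\mathbb{S}_n$ act on $P_n=K[x_1,\dots,x_n]$ so that $x_i$ acts by multiplication and $y_i*x^\alpha=x^{\alpha-e_i}$ if $\alpha_i>0$, $y_i*x^\alpha=0$ if $\alpha_i=0$. Put $E_{ij}(k)=x_k^iy_k^j-x_k^{i+1}y_k^{j+1}$ for $i,j\in\mathbb{N}=\{0,1,\dots\}$, and, for $s\in\mathbb{S}_1$, let $s(k)$ be the image of $s$ under the homomorphism $\mathbb{S}_1\to\mathbb{S}_2$, $x_1\mapsto x_k$, $y_1\mapsto y_k$. In $\mathbb{S}_1$ let $F=\sum_{i,j\ge 0} KE_{ij}$, and in $\mathbb{S}_2$ let $\mathfrak{p}_1=F(1)\otimes\mathbb{S}_1(2)$ (the span of the products $f(1)s(2)$ with $f\in F$, $s\in\mathbb{S}_1$) and $F_2=F(1)\otimes F(2)=\sum_{\alpha,\beta\in\mathbb{N}^2}KE_{\alpha\beta}$,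 where $E_{\alpha\beta}=E_{\alpha_1\beta_1}(1)E_{\alpha_2\beta_2}(2)$. For $I=\mathfrak{p}_1$ or $I=F_2$, let $(1+I)^*$ be the group of units of the multiplicative monoid $1+I$. For a ring $R$, let $M_\infty(R)$ be the ring (without $1$) of $\mathbb{N}\times\mathbb{N}$ matrices over $R$ with finitely many nonzero entries, and let $\mathrm{GL}_\infty(R)$ be the group of units of the monoid $1+M_\infty(R)$. The group $\mathrm{GL}_\infty(\mathbb{S}_1)$ is identified with $(1+\mathfrak{p}_1)^*$ via $1+\sum a_{ij}E_{ij}\mapsto 1+\sum a_{ij}(2)E_{ij}(1)$. Let $b:\mathbb{N}^2\to\mathbb{N}$ be any bijection, and let $\det:(1+F_2)^*\to K^*$ be the homomorphism obtained from the determinant $\mathrm{GL}_\infty(K)\to K^*$ (the determinant of a sufficiently large upper left block) through the isomorphism $(1+F_2)^*\simeq\mathrm{GL}_\infty(K)$, $1+\sum\lambda_{\alpha\beta}E_{\alpha\beta}\mapsto 1+\sum\lambda_{\alpha\beta}E_{b(\alpha)b(\beta)}$. Let $\mathrm{SL}=\{u\in(1+F_2)^*\mid\det(u)=1\}$, and let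 $\eta$ be the involution of $\mathbb{S}_2$, i.e. the $K$-algebra anti-automorphism with $\eta(x_i)=y_i$, $\eta(y_i)=x_i$ for $i=1,2$. Then: 1. For every $u\in(1+F_2)^*$, $\eta(u)\in(1+F_2)^*$ and $\det(\eta(u))=\det(u)$. 2. Let $a\in\mathrm{GL}_\infty(\mathbb{S}_1)=(1+\mathfrak{p}_1)^*$, and let $V_0\subseteq V_1\subseteq\cdots$ be finite dimensional subspaces of $P_2$ with $P_2=\bigcup_{i}V_i$ such that $a(V_i)\subseteq V_i$ for all $i\gg 0$. Then, for every $u\in(1+F_2)^*$, $aua^{-1}\in(1+F_2)^*$ and $\det(aua^{-1})=\det(u)$. 3. For all $a\in\mathrm{GL}_\infty(\mathbb{S}_1)$ and $u\in(1+F_2)^*$, $aua^{-1}\in(1+F_2)^*$ and $\det(aua^{-1})=\det(u)$. 4. $\mathrm{SL}$ is a normal subgroup of $\mathrm{GL}_\infty(\mathbb{S}_1)$. Moreover, every subgroup $N$ of $(1+F_2)^*$ that contains $\mathrm{SL}$ is a normal subgroup of $\mathrm{GL}_\infty(\mathbb{S}_1)$. -/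

import Mathlib

noncomputable section

namespace OneSided

/-! ### Groups of units of monoids of the form `1 + I` -/

section OnePlus

variable {A : Type*} [Ring A]

/-- For a multiplicatively closed additive subgroup `I` of a ring `A`, the group `(1 + I)^*` of
units of the monoid `1 + I`, as a subgroup of the group of units of `A`. -/
def onePlusUnits (I : NonUnitalSubring A) : Subgroup Aˣ where
  carrier := {u | (u : A) - 1 ∈ I ∧ ((u⁻¹ : Aˣ) : A) - 1 ∈ I}
  one_mem' := by simp [I.zero_mem]
  mul_mem' := by
    have key : ∀ a b : A, a - 1 ∈ I → b - 1 ∈ I → a * b - 1 ∈ I := fun a b ha hb => by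
      have h := I.add_mem (I.add_mem (I.mul_mem ha hb) ha) hb
      have e : (a - 1) * (b - 1) + (a - 1) + (b - 1) = a * b - 1 := by noncomm_ring
      rwa [e] at h
    rintro u v ⟨hu, hu'⟩ ⟨hv, hv'⟩
    refine ⟨?_, ?_⟩
    · simpa using key _ _ hu hv
    · simpa using key _ _ hv' hu'
  inv_mem' := by
    rintro u ⟨hu, hu'⟩
    exact ⟨hu', by simpa using hu⟩

variable {B : Type*} [Ring B] {I : NonUnitalSubring A} {J : NonUnitalSubring B}

/-- The homomorphism `(1 + I)^* → (1 + J)^*` induced by a ring homomorphism mapping `I` to `J`. -/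
def onePlusMap (φ : A →+* B) (h : ∀ a ∈ I, φ a ∈ J) : onePlusUnits I →* onePlusUnits J :=
  ((Units.map φ.toMonoidHom).comp (onePlusUnits I).subtype).codRestrict (onePlusUnits J)
    fun u => by
      have h1 := h _ u.2.1
      have h2 := h _ u.2.2
      rw [map_sub, map_one] at h1 h2
      exact ⟨h1, h2⟩

theorem onePlusMap_bijective (φ : A →+* B) (h : ∀ a ∈ I, φ a ∈ J)
    (hinj : ∀ a ∈ I, φ a = 0 → a = 0) (hsurj : ∀ c ∈ J, ∃ a ∈ I, φ a = c) :
    Function.Bijective (onePlusMap φ h) := by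
  have key : ∀ a c : A, a ∈ I → c ∈ I → φ (1 + a) * φ (1 + c) = 1 → (1 + a) * (1 + c) = 1 := by
    intro a c ha hc hac
    have e : (1 + a) * (1 + c) - 1 = a + c + a * c := by noncomm_ring
    have hm : (1 + a) * (1 + c) - 1 ∈ I := by
      rw [e]; exact I.add_mem (I.add_mem ha hc) (I.mul_mem ha hc)
    have h0 := hinj _ hm (by rw [map_sub, map_mul, hac, map_one, sub_self])
    exact sub_eq_zero.1 h0
  constructor
  · rw [injective_iff_map_eq_one]
    intro u hu
    have h1 : φ ((u : Aˣ) : A) = 1 := congrArg (fun v : onePlusUnits J => ((v : Bˣ) : B)) hu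
    have h2 := hinj _ u.2.1 (by rw [map_sub, h1, map_one, sub_self])
    exact Subtype.ext (Units.ext (sub_eq_zero.1 h2))
  · intro v
    obtain ⟨a, ha, hav⟩ := hsurj _ v.2.1
    obtain ⟨c, hc, hcv⟩ := hsurj _ v.2.2
    have h1 : φ (1 + a) = ((v : Bˣ) : B) := by rw [map_add, hav, map_one]; abel
    have h2 : φ (1 + c) = (((v : Bˣ)⁻¹ : Bˣ) : B) := by rw [map_add, hcv, map_one]; abel
    refine ⟨⟨⟨1 + a, 1 + c, key a c ha hc ?_, key c a hc ha ?_⟩, ?_, ?_⟩, ?_⟩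
    · rw [h1, h2, Units.mul_inv]
    · rw [h1, h2, Units.inv_mul]
    · simpa using ha
    · simpa using hc
    · exact Subtype.ext (Units.ext h1)

end OnePlus

/-! ### Infinite matrices, `M_∞(R)`, `GL_∞(R)` and its determinant -/

section Matrices

/-- The ring of column-finite `ℕ × ℕ` matrices over `R`: right `R`-linear endomorphisms of the
free right `R`-module of column vectors `⨁_{i ∈ ℕ} e_i R`. -/
abbrev ColFin (R : Type*) [Ring R] : Type _ := Module.End Rᵐᵒᵖ (ℕ →₀ R)

variable {R : Type*} [Ring R]

/-- The `(i, j)` entry of a column-finite matrix. -/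
def entry (f : ColFin R) (i j : ℕ) : R := f (Finsupp.single j 1) i

theorem ColFin.apply_single (f : ColFin R) (j : ℕ) (r : R) (i : ℕ) :
    f (Finsupp.single j r) i = entry f i j * r := by
  have h : (Finsupp.single j r : ℕ →₀ R) = MulOpposite.op r • Finsupp.single j (1 : R) := by
    rw [Finsupp.smul_single]; simp
  rw [h, map_smul]; simp [entry]

theorem ColFin.ext_entry {f g : ColFin R} (h : ∀ i j, entry f i j = entry g i j) : f = g := by
  refine LinearMap.ext fun v => ?_
  induction v using Finsupp.induction_linear with
  | zero => simp
  | add v w hv hw => rw [map_add, map_add, hv, hw]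
  | single j r => ext i; rw [ColFin.apply_single, ColFin.apply_single, h]

theorem entry_mul (f g : ColFin R) (i j : ℕ) :
    entry (f * g) i j = (g (Finsupp.single j 1)).sum fun k r => entry f i k * r := by
  have h : ∀ v : ℕ →₀ R, f v i = v.sum fun k r => entry f i k * r := by
    intro v
    induction v using Finsupp.induction_linear with
    | zero => simp
    | add v w hv hw =>
      rw [map_add, Finsupp.add_apply, hv, hw, Finsupp.sum_add_index'] <;> simp [mul_add]
    | single j r => rw [ColFin.apply_single, Finsupp.sum_single_index]; simp
  exact h _

@[simp] theorem entry_add (f g : ColFin R) (i j : ℕ) :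
    entry (f + g) i j = entry f i j + entry g i j := rfl

@[simp] theorem entry_sub (f g : ColFin R) (i j : ℕ) :
    entry (f - g) i j = entry f i j - entry g i j := rfl

@[simp] theorem entry_zero (i j : ℕ) : entry (0 : ColFin R) i j = 0 := rfl

theorem entry_one (i j : ℕ) : entry (1 : ColFin R) i j = if i = j then 1 else 0 := by
  simp [entry, Finsupp.single_apply, eq_comm]

/-- Taking an entry, as an additive homomorphism. -/
def entryHom (i j : ℕ) : ColFin R →+ R where
  toFun f := entry f i j
  map_zero' := rfl
  map_add' _ _ := rfl

/-- All entries of `f` outside the upper left `d × d` block vanish, i.e. `f ∈ M_d(R)`. -/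
def InBlock (d : ℕ) (f : ColFin R) : Prop := ∀ i j, d ≤ i ∨ d ≤ j → entry f i j = 0

theorem InBlock.mono {d e : ℕ} (h : d ≤ e) {f : ColFin R} (hf : InBlock d f) : InBlock e f :=
  fun i j hij => hf i j (hij.imp h.trans h.trans)

theorem InBlock.entry_mul {d : ℕ} {g : ColFin R} (hg : InBlock d g) (f : ColFin R) (i j : ℕ) :
    entry (f * g) i j = ∑ k ∈ Finset.range d, entry f i k * entry g k j := by
  rw [OneSided.entry_mul]
  refine Finsupp.sum_of_support_subset _ ?_ _ (by simp)
  intro k hk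
  rw [Finset.mem_range]
  by_contra hd
  exact (Finsupp.mem_support_iff.1 hk) (hg k j (Or.inl (not_lt.1 hd)))

variable (R) in
/-- `M_∞(R) = ⋃_d M_d(R)`: the ring (without 1) of matrices with finitely many nonzero entries. -/
def MInf : NonUnitalSubring (ColFin R) where
  carrier := {f | ∃ d, InBlock d f}
  zero_mem' := ⟨0, fun _ _ _ => rfl⟩
  add_mem' := by
    rintro f g ⟨d, hf⟩ ⟨e, hg⟩
    refine ⟨max d e, fun i j hij => ?_⟩
    rw [entry_add, hf.mono (le_max_left d e) i j hij, hg.mono (le_max_right d e) i j hij, add_zero]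
  neg_mem' := by
    rintro f ⟨d, hf⟩
    refine ⟨d, fun i j hij => ?_⟩
    have : entry (-f) i j = - entry f i j := rfl
    rw [this, hf i j hij, neg_zero]
  mul_mem' := by
    rintro f g ⟨d, hf⟩ ⟨e, hg⟩
    refine ⟨max d e, fun i j hij => ?_⟩
    rw [(hg.mono (le_max_right d e)).entry_mul]
    refine Finset.sum_eq_zero fun k _ => ?_
    rcases hij with hi | hj
    · rw [hf.mono (le_max_left d e) i k (Or.inl hi), zero_mul]
    · rw [hg.mono (le_max_right d e) k j (Or.inr hj), mul_zero]

variable (R) in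
/-- `GL_∞(R)`: the group of units of the monoid `1 + M_∞(R)`. -/
def GLInf : Subgroup (ColFin R)ˣ := onePlusUnits (MInf R)

/-- The upper left `d × d` block. -/
def block (d : ℕ) (f : ColFin R) : Matrix (Fin d) (Fin d) R := Matrix.of fun i j => entry f i j

end Matrices

section Det

variable {k : Type*} [CommRing k]

theorem det_block_succ {d : ℕ} {f : ColFin k} (hf : InBlock d (f - 1)) :
    (block (d + 1) f).det = (block d f).det := by
  have h0 : ∀ i : Fin d, block (d + 1) f (Fin.castSucc i) (Fin.last d) = 0 := by
    intro i
    have h := hf i d (Or.inr le_rfl)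
    rw [entry_sub, entry_one, if_neg i.2.ne, sub_zero] at h
    exact h
  have h1 : block (d + 1) f (Fin.last d) (Fin.last d) = 1 := by
    have h := hf d d (Or.inr le_rfl)
    rw [entry_sub, entry_one, if_pos rfl, sub_eq_zero] at h
    exact h
  rw [Matrix.det_succ_column _ (Fin.last d), Fin.sum_univ_castSucc]
  rw [Finset.sum_eq_zero (fun i _ => by rw [h0]; simp), h1]
  simp only [zero_add, mul_one, Fin.val_last]
  rw [← two_mul, pow_mul, neg_one_sq, one_pow, one_mul]
  congr 1
  ext i j
  simp [block, Matrix.submatrix_apply]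

theorem det_block_eq {d e : ℕ} {f : ColFin k} (hd : InBlock d (f - 1)) (he : InBlock e (f - 1)) :
    (block d f).det = (block e f).det := by
  have key : ∀ n, (block (d + n) f).det = (block d f).det ∧
      (block (e + n) f).det = (block e f).det := by
    intro n
    induction n with
    | zero => simp
    | succ n ih =>
      exact ⟨(det_block_succ (hd.mono (Nat.le_add_right d n))).trans ih.1,
        (det_block_succ (he.mono (Nat.le_add_right e n))).trans ih.2⟩
  rw [← (key e).1, ← (key d).2, add_comm]

theorem block_mul {d : ℕ} {f g : ColFin k} (hg : InBlock d (g - 1)) :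
    block d (f * g) = block d f * block d g := by
  ext i j
  have h : f * g = f * (g - 1) + f := LinearMap.ext fun v => by simp [Module.End.mul_apply]
  have e1 : block d (f * g) i j = entry (f * g) i j := rfl
  rw [e1, h, entry_add, hg.entry_mul, Matrix.mul_apply, ← Fin.sum_univ_eq_sum_range
    (fun l => entry f i l * entry (g - 1) l j) d]
  have : ∀ l : Fin d, entry f i l * entry (g - 1) l j =
      block d f i l * block d g l j - block d f i l * (1 : Matrix (Fin d) (Fin d) k) l j := by
    intro l
    rw [entry_sub, entry_one, Matrix.one_apply, mul_sub]
    simp only [block, Matrix.of_apply, Fin.ext_iff]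
  simp only [this]
  rw [Finset.sum_sub_distrib, ← Matrix.mul_apply, ← Matrix.mul_apply, mul_one]
  simp [block]

variable (k) in
/-- The determinant `GL_∞(k) → k^*`: the determinant of the upper left `d × d` block for any
sufficiently large `d`. -/
def detGLInf : GLInf k →* kˣ :=
  MonoidHom.toHomUnits
    { toFun := fun u => (block (Classical.choose u.2.1) ((u : (ColFin k)ˣ) : ColFin k)).det
      map_one' := by
        have h0 : InBlock 0 ((((1 : GLInf k) : (ColFin k)ˣ) : ColFin k) - 1) := by
          intro i j _; simp
        rw [det_block_eq (Classical.choose_spec (1 : GLInf k).2.1) h0, Matrix.det_isEmpty]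
      map_mul' := by
        intro u v
        obtain ⟨d, hd⟩ := u.2.1
        obtain ⟨e, he⟩ := v.2.1
        obtain ⟨n, hn⟩ := (u * v).2.1
        have h1 := hd.mono (show d ≤ d + e + n by omega)
        have h2 := he.mono (show e ≤ d + e + n by omega)
        have h3 := hn.mono (show n ≤ d + e + n by omega)
        rw [det_block_eq (Classical.choose_spec (u * v).2.1) h3,
          det_block_eq (Classical.choose_spec u.2.1) h1,
          det_block_eq (Classical.choose_spec v.2.1) h2, ← Matrix.det_mul, ← block_mul h2]
        rfl }

theorem detGLInf_eq (u : GLInf k) {d : ℕ} (hd : InBlock d (((u : (ColFin k)ˣ) : ColFin k) - 1)) :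
    (detGLInf k u : k) = (block d ((u : (ColFin k)ˣ) : ColFin k)).det :=
  det_block_eq (Classical.choose_spec u.2.1) hd

end Det

/-! ### The algebras `S_n` of one-sided inverses -/

section Alg

open MvPolynomial

variable (K : Type*) [Field K] (n : ℕ)

/-- The defining relations of `S_n`; the generator `x_i` is `Sum.inl i`, and `y_i` is
`Sum.inr i`. -/
inductive SRel : FreeAlgebra K (Fin n ⊕ Fin n) → FreeAlgebra K (Fin n ⊕ Fin n) → Prop
  | yx (i : Fin n) : SRel (FreeAlgebra.ι K (Sum.inr i) * FreeAlgebra.ι K (Sum.inl i)) 1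
  | xy (i j : Fin n) (h : i ≠ j) :
      SRel (FreeAlgebra.ι K (Sum.inl i) * FreeAlgebra.ι K (Sum.inr j))
        (FreeAlgebra.ι K (Sum.inr j) * FreeAlgebra.ι K (Sum.inl i))
  | xx (i j : Fin n) (h : i ≠ j) :
      SRel (FreeAlgebra.ι K (Sum.inl i) * FreeAlgebra.ι K (Sum.inl j))
        (FreeAlgebra.ι K (Sum.inl j) * FreeAlgebra.ι K (Sum.inl i))
  | yy (i j : Fin n) (h : i ≠ j) :
      SRel (FreeAlgebra.ι K (Sum.inr i) * FreeAlgebra.ι K (Sum.inr j))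
        (FreeAlgebra.ι K (Sum.inr j) * FreeAlgebra.ι K (Sum.inr i))

/-- The algebra `S_n` of one-sided inverses of the polynomial algebra in `n` variables. -/
def S : Type _ := RingQuot (SRel K n)

instance : Ring (S K n) := inferInstanceAs (Ring (RingQuot (SRel K n)))

instance : Algebra K (S K n) := inferInstanceAs (Algebra K (RingQuot (SRel K n)))

namespace S

variable {K n}

/-- The canonical generators `x_i`. -/
def x (i : Fin n) : S K n := RingQuot.mkAlgHom K (SRel K n) (FreeAlgebra.ι K (Sum.inl i))

/-- The canonical generators `y_i`. -/
def y (i : Fin n) : S K n := RingQuot.mkAlgHom K (SRel K n) (FreeAlgebra.ι K (Sum.inr i))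

theorem y_mul_x (i : Fin n) : (y i : S K n) * x i = 1 := by
  have h := RingQuot.mkAlgHom_rel K (SRel.yx (K := K) i)
  rw [map_mul, map_one] at h
  exact h

theorem x_mul_y {i j : Fin n} (hij : i ≠ j) : (x i : S K n) * y j = y j * x i := by
  have h := RingQuot.mkAlgHom_rel K (SRel.xy (K := K) i j hij)
  rw [map_mul, map_mul] at h
  exact h

theorem x_mul_x {i j : Fin n} (hij : i ≠ j) : (x i : S K n) * x j = x j * x i := by
  have h := RingQuot.mkAlgHom_rel K (SRel.xx (K := K) i j hij)
  rw [map_mul, map_mul] at h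
  exact h

theorem y_mul_y {i j : Fin n} (hij : i ≠ j) : (y i : S K n) * y j = y j * y i := by
  have h := RingQuot.mkAlgHom_rel K (SRel.yy (K := K) i j hij)
  rw [map_mul, map_mul] at h
  exact h

section lift

variable {A : Type*} [Ring A] [Algebra K A]

/-- The universal property of `S_n`. -/
def lift (X Y : Fin n → A) (hyx : ∀ i, Y i * X i = 1)
    (hxy : ∀ i j, i ≠ j → X i * Y j = Y j * X i) (hxx : ∀ i j, i ≠ j → X i * X j = X j * X i)
    (hyy : ∀ i j, i ≠ j → Y i * Y j = Y j * Y i) : S K n →ₐ[K] A :=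
  RingQuot.liftAlgHom K ⟨FreeAlgebra.lift K (Sum.elim X Y), by
    intro a b h
    induction h with
    | yx i => simpa using hyx i
    | xy i j h => simpa using hxy i j h
    | xx i j h => simpa using hxx i j h
    | yy i j h => simpa using hyy i j h⟩

variable (X Y : Fin n → A) (hyx : ∀ i, Y i * X i = 1)
    (hxy : ∀ i j, i ≠ j → X i * Y j = Y j * X i) (hxx : ∀ i j, i ≠ j → X i * X j = X j * X i)
    (hyy : ∀ i j, i ≠ j → Y i * Y j = Y j * Y i)

@[simp] theorem lift_x (i : Fin n) : lift (K := K) X Y hyx hxy hxx hyy (x i) = X i := by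
  unfold lift x
  erw [RingQuot.liftAlgHom_mkAlgHom_apply]
  simp

@[simp] theorem lift_y (i : Fin n) : lift (K := K) X Y hyx hxy hxx hyy (y i) = Y i := by
  unfold lift y
  erw [RingQuot.liftAlgHom_mkAlgHom_apply]
  simp

theorem algHom_ext {f g : S K n →ₐ[K] A} (hx : ∀ i, f (x i) = g (x i))
    (hy : ∀ i, f (y i) = g (y i)) : f = g := by
  refine RingQuot.ringQuot_ext' (S := K) (s := SRel K n) f g (FreeAlgebra.hom_ext ?_)
  funext i
  rcases i with i | i
  · exact hx i
  · exact hy i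

end lift

/-- The involution `η` of `S_n`, `x_i ↦ y_i`, `y_i ↦ x_i`, as a homomorphism to the opposite
algebra. -/
def eta : S K n →ₐ[K] (S K n)ᵐᵒᵖ :=
  lift (fun i => MulOpposite.op (y i)) (fun i => MulOpposite.op (x i))
    (fun i => by rw [← MulOpposite.op_mul, y_mul_x, MulOpposite.op_one])
    (fun i j h => by rw [← MulOpposite.op_mul, ← MulOpposite.op_mul, x_mul_y h.symm])
    (fun i j h => by rw [← MulOpposite.op_mul, ← MulOpposite.op_mul, y_mul_y h])
    (fun i j h => by rw [← MulOpposite.op_mul, ← MulOpposite.op_mul, x_mul_x h])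

/-- The unit `η(u)`, for a unit `u` of `S_n`. -/
def etaUnit (u : (S K n)ˣ) : (S K n)ˣ :=
  (Units.opEquiv (Units.map (eta (K := K) (n := n)).toRingHom.toMonoidHom u)).unop

/-- The operator `y_i` on the polynomial algebra `P_n`: `x^α ↦ x^{α - e_i}` if `α_i > 0`, and
`x^α ↦ 0` if `α_i = 0`. -/
def lower (i : Fin n) : Module.End K (MvPolynomial (Fin n) K) where
  toFun p := p.divMonomial (Finsupp.single i 1)
  map_add' p q := add_divMonomial p q _
  map_smul' c p := by ext m; simp [coeff_divMonomial]

theorem coeff_lower (i : Fin n) (p : MvPolynomial (Fin n) K) (m : Fin n →₀ ℕ) :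
    coeff m (lower i p) = coeff (Finsupp.single i 1 + m) p := coeff_divMonomial _ _ _

/-- The `S_n`-module structure of the polynomial algebra `P_n = K[x_1, …, x_n]`. -/
def act : S K n →ₐ[K] Module.End K (MvPolynomial (Fin n) K) :=
  lift (fun i => LinearMap.mulLeft K (X i)) lower
    (fun i => by
      refine LinearMap.ext fun p => ?_
      ext m
      simp [coeff_lower])
    (fun i j h => by
      refine LinearMap.ext fun p => ?_
      ext m
      simp only [Module.End.mul_apply, coeff_lower, LinearMap.mulLeft_apply, coeff_X_mul',
        Finsupp.mem_support_iff, Finsupp.add_apply, Finsupp.single_apply, if_neg h.symm, zero_add]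
      split_ifs with hm
      · congr 1
        ext t
        simp only [Finsupp.add_apply, Finsupp.tsub_apply, Finsupp.single_apply]
        split_ifs with h1 h2 <;> omega
      · rfl)
    (fun i j _ => by
      refine LinearMap.ext fun p => ?_
      simp only [Module.End.mul_apply, LinearMap.mulLeft_apply]
      ring)
    (fun i j _ => by
      refine LinearMap.ext fun p => ?_
      ext m
      simp only [Module.End.mul_apply, coeff_lower]
      congr 1
      abel)

/-- The element `E_{ij}(k) = x_k^i y_k^j - x_k^{i+1} y_k^{j+1}` of `S_n`. -/
def E (k : Fin n) (i j : ℕ) : S K n := x k ^ i * y k ^ j - x k ^ (i + 1) * y k ^ (j + 1)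

/-- The canonical homomorphism from `S_1` onto the subalgebra `S_1(k)` of `S_n` generated by
`x_k` and `y_k`. -/
def incl (k : Fin n) : S K 1 →ₐ[K] S K n :=
  lift (fun _ => x k) (fun _ => y k) (fun _ => y_mul_x k)
    (fun i j h => absurd (Subsingleton.elim i j) h) (fun _ _ _ => rfl) (fun _ _ _ => rfl)

variable (K) in
/-- The ideal `F = ⨁ K E_{ij}` of `S_1`. -/
def F : Submodule K (S K 1) := Submodule.span K (Set.range fun p : ℕ × ℕ => E 0 p.1 p.2)

theorem y_pow_mul_x_pow_of_le (k : Fin n) {i j : ℕ} (h : i ≤ j) :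
    (y k : S K n) ^ j * x k ^ i = y k ^ (j - i) := by
  induction i generalizing j with
  | zero => simp
  | succ i ih =>
    obtain ⟨j, rfl⟩ := Nat.exists_eq_add_of_lt (Nat.lt_of_succ_le h)
    rw [pow_succ, pow_succ', mul_assoc, ← mul_assoc (y k), y_mul_x, one_mul, ih (by omega)]
    congr 1
    omega

theorem y_pow_mul_x_pow_of_ge (k : Fin n) {i j : ℕ} (h : j ≤ i) :
    (y k : S K n) ^ j * x k ^ i = x k ^ (i - j) := by
  induction j generalizing i with
  | zero => simp
  | succ j ih =>
    obtain ⟨i, rfl⟩ := Nat.exists_eq_add_of_lt (Nat.lt_of_succ_le h)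
    rw [pow_succ, pow_succ', mul_assoc, ← mul_assoc (y k), y_mul_x, one_mul, ih (by omega)]
    congr 1
    omega

theorem E_mul_E (k : Fin n) (i j l m : ℕ) :
    (E k i j : S K n) * E k l m = if j = l then E k i m else 0 := by
  have e : (E k i j : S K n) * E k l m =
      x k ^ i * (y k ^ j * x k ^ l) * y k ^ m
        - x k ^ i * (y k ^ j * x k ^ (l + 1)) * y k ^ (m + 1)
        - x k ^ (i + 1) * (y k ^ (j + 1) * x k ^ l) * y k ^ m
        + x k ^ (i + 1) * (y k ^ (j + 1) * x k ^ (l + 1)) * y k ^ (m + 1) := by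
    unfold E
    noncomm_ring
  rw [e]
  rcases lt_trichotomy j l with h | h | h
  · rw [if_neg h.ne, y_pow_mul_x_pow_of_ge k h.le, y_pow_mul_x_pow_of_ge k (by omega : j ≤ l + 1),
      y_pow_mul_x_pow_of_ge k (by omega : j + 1 ≤ l),
      y_pow_mul_x_pow_of_ge k (by omega : j + 1 ≤ l + 1), ← pow_add, ← pow_add, ← pow_add,
      ← pow_add, show i + 1 + (l - (j + 1)) = i + (l - j) by omega,
      show i + 1 + (l + 1 - (j + 1)) = i + (l + 1 - j) by omega]
    abel
  · subst h
    rw [if_pos rfl, y_pow_mul_x_pow_of_ge k le_rfl, y_pow_mul_x_pow_of_ge k (by omega : j ≤ j + 1),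
      y_pow_mul_x_pow_of_le k (by omega : j ≤ j + 1), y_pow_mul_x_pow_of_ge k le_rfl]
    simp only [Nat.sub_self, pow_zero, mul_one, Nat.add_sub_cancel_left, pow_one]
    rw [mul_assoc (x k ^ (i + 1)) (y k), ← pow_succ' (y k), ← pow_succ (x k)]
    unfold E
    abel
  · rw [if_neg h.ne', y_pow_mul_x_pow_of_le k h.le, y_pow_mul_x_pow_of_le k (by omega : l + 1 ≤ j),
      y_pow_mul_x_pow_of_le k (by omega : l ≤ j + 1),
      y_pow_mul_x_pow_of_le k (by omega : l + 1 ≤ j + 1)]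
    simp only [mul_assoc, ← pow_add]
    rw [show j - (l + 1) + (m + 1) = j - l + m by omega,
      show j + 1 - (l + 1) + (m + 1) = j + 1 - l + m by omega]
    abel

theorem incl_E (k : Fin n) (i j : ℕ) : incl k (E 0 i j : S K 1) = E k i j := by
  simp [E, incl]

theorem F_mul_F : F K * F K ≤ F K := by
  rw [F, Submodule.span_mul_span, Submodule.span_le]
  rintro _ ⟨_, ⟨p, rfl⟩, _, ⟨q, rfl⟩, rfl⟩
  simp only [E_mul_E]
  split_ifs
  · exact Submodule.subset_span ⟨(p.1, q.2), rfl⟩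
  · exact Submodule.zero_mem _

theorem mem_of_generators (T : Subalgebra K (S K n)) (hx : ∀ i, x i ∈ T) (hy : ∀ i, y i ∈ T)
    (a : S K n) : a ∈ T := by
  let f : S K n →ₐ[K] T := lift (fun i => ⟨x i, hx i⟩) (fun i => ⟨y i, hy i⟩)
    (fun i => Subtype.ext (y_mul_x i)) (fun i j h => Subtype.ext (x_mul_y h))
    (fun i j h => Subtype.ext (x_mul_x h)) (fun i j h => Subtype.ext (y_mul_y h))
  have h : T.val.comp f = AlgHom.id K (S K n) :=
    algHom_ext (fun i => by simp [f]) (fun i => by simp [f])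
  have h2 : ((f a : T) : S K n) = a := congrArg (fun g : S K n →ₐ[K] S K n => g a) h
  rw [← h2]
  exact (f a).2

@[simp] theorem incl_x (k : Fin n) (i : Fin 1) : incl k (x i : S K 1) = x k := by simp [incl]

@[simp] theorem incl_y (k : Fin n) (i : Fin 1) : incl k (y i : S K 1) = y k := by simp [incl]

theorem mem_comap_centralizer (k : Fin n) (c : S K n) (b : S K 1) :
    b ∈ (Subalgebra.centralizer K {c}).comap (incl k) ↔ Commute c (incl k b) := by
  simp [Subalgebra.mem_centralizer_iff, Commute, SemiconjBy]

theorem commute_incl (k : Fin n) (c : S K n) (hx : Commute c (x k)) (hy : Commute c (y k))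
    (b : S K 1) : Commute c (incl k b) :=
  (mem_comap_centralizer k c b).1 (mem_of_generators _
    (fun i => (mem_comap_centralizer k c _).2 (by rwa [incl_x]))
    (fun i => (mem_comap_centralizer k c _).2 (by rwa [incl_y])) b)

theorem incl_commute (a b : S K 1) : Commute (incl (0 : Fin 2) a) (incl (1 : Fin 2) b) := by
  have h01 : (0 : Fin 2) ≠ 1 := by decide
  exact (commute_incl 0 _ (commute_incl 1 _ (x_mul_x h01) (x_mul_y h01) b).symm
    (commute_incl 1 _ (x_mul_y h01.symm).symm (y_mul_y h01) b).symm a).symm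

theorem map_mul_map_comm (M N : Submodule K (S K 1)) :
    M.map (incl (0 : Fin 2)).toLinearMap * N.map (incl (1 : Fin 2)).toLinearMap =
      N.map (incl (1 : Fin 2)).toLinearMap * M.map (incl (0 : Fin 2)).toLinearMap := by
  refine Submodule.mul_comm_of_commute ?_
  intro m hm n hn
  obtain ⟨a, _, rfl⟩ := hm
  obtain ⟨b, _, rfl⟩ := hn
  exact incl_commute a b

theorem map_mul_map_closed {M N : Submodule K (S K 1)} (hM : M * M ≤ M) (hN : N * N ≤ N) :
    ∀ a b, a ∈ M.map (incl (0 : Fin 2)).toLinearMap * N.map (incl (1 : Fin 2)).toLinearMap →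
      b ∈ M.map (incl (0 : Fin 2)).toLinearMap * N.map (incl (1 : Fin 2)).toLinearMap →
      a * b ∈ M.map (incl (0 : Fin 2)).toLinearMap * N.map (incl (1 : Fin 2)).toLinearMap := by
  intro a b ha hb
  have h := Submodule.mul_mem_mul ha hb
  rw [mul_assoc, ← mul_assoc (N.map _), ← map_mul_map_comm M N, mul_assoc, ← mul_assoc,
    ← Submodule.map_mul, ← Submodule.map_mul] at h
  exact mul_le_mul' (Submodule.map_mono hM) (Submodule.map_mono hN) h

variable (K) in
/-- The ideal `𝔭_1 = F(1) ⊗ S_1(2)` of `S_2 = S_1(1) ⊗ S_1(2)`: the linear span of all products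
`f(1) s(2)` with `f ∈ F` and `s ∈ S_1`. -/
def p1 : NonUnitalSubring (S K 2) :=
  (Submodule.toNonUnitalSubalgebra
    ((F K).map (incl (0 : Fin 2)).toLinearMap *
      (⊤ : Submodule K (S K 1)).map (incl (1 : Fin 2)).toLinearMap)
    (map_mul_map_closed F_mul_F le_top)).toNonUnitalSubring

variable (K) in
/-- The ideal `F_2 = F(1) ⊗ F(2)` of `S_2 = S_1(1) ⊗ S_1(2)`: the linear span of all products
`f(1) g(2)` with `f, g ∈ F`. -/
def F2 : NonUnitalSubring (S K 2) :=
  (Submodule.toNonUnitalSubalgebra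
    ((F K).map (incl (0 : Fin 2)).toLinearMap * (F K).map (incl (1 : Fin 2)).toLinearMap)
    (map_mul_map_closed F_mul_F F_mul_F)).toNonUnitalSubring

/-! ### The identification of `GL_∞(S_1)` with `(1 + 𝔭_1)^*` -/

/-- The shift `e_i ↦ e_{i+1}`. -/
def up (R : Type*) [Ring R] : ColFin R := Finsupp.lmapDomain R Rᵐᵒᵖ Nat.succ

/-- The shift `e_i ↦ e_{i-1}`, where `e_{-1} = 0`. -/
def down (R : Type*) [Ring R] : ColFin R := Finsupp.lcomapDomain Nat.succ Nat.succ_injective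

/-- The scalar matrix with all diagonal entries equal to `s`. -/
def diag {R : Type*} [Ring R] (s : R) : ColFin R := Module.toModuleEnd Rᵐᵒᵖ (ℕ →₀ R) s

section shifts

variable {R : Type*} [Ring R]

theorem diag_single (s : R) (j : ℕ) (r : R) :
    diag s (Finsupp.single j r) = Finsupp.single j (s * r) := by
  simp [diag, Finsupp.smul_single]

theorem up_single (j : ℕ) (r : R) :
    up R (Finsupp.single j r) = Finsupp.single (j + 1) r := by
  simp [up, Finsupp.lmapDomain_apply]

theorem down_single_zero (r : R) : down R (Finsupp.single 0 r) = 0 := by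
  ext i
  simp [down, Finsupp.lcomapDomain]

theorem down_single_succ (j : ℕ) (r : R) :
    down R (Finsupp.single (j + 1) r) = Finsupp.single j r := by
  ext i
  simp [down, Finsupp.lcomapDomain, Finsupp.single_apply]

theorem colFin_ext {f g : ColFin R}
    (h : ∀ j r, f (Finsupp.single j r) = g (Finsupp.single j r)) : f = g :=
  ColFin.ext_entry fun i j => by simp only [entry, h]

theorem down_mul_up : down R * up R = 1 :=
  colFin_ext fun j r => by simp [Module.End.mul_apply, up_single, down_single_succ]

theorem up_mul_diag (s : R) : up R * diag s = diag s * up R :=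
  colFin_ext fun j r => by
    simp only [Module.End.mul_apply, up_single, diag_single]

theorem down_mul_diag (s : R) : down R * diag s = diag s * down R :=
  colFin_ext fun j r => by
    cases j <;>
      simp only [Module.End.mul_apply, down_single_succ, down_single_zero, diag_single, map_zero]

theorem diag_mul (s t : R) : diag (s * t) = diag s * diag t :=
  map_mul (Module.toModuleEnd Rᵐᵒᵖ (ℕ →₀ R)) s t

theorem diag_one : diag (1 : R) = 1 := map_one (Module.toModuleEnd Rᵐᵒᵖ (ℕ →₀ R))

theorem up_pow_single (i j : ℕ) (r : R) :
    (up R ^ i) (Finsupp.single j r) = Finsupp.single (j + i) r := by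
  induction i generalizing j with
  | zero => simp
  | succ i ih => rw [pow_succ, Module.End.mul_apply, up_single, ih]; congr 1; omega

theorem down_pow_single (i j : ℕ) (r : R) :
    (down R ^ i) (Finsupp.single j r) = if i ≤ j then Finsupp.single (j - i) r else 0 := by
  induction i generalizing j with
  | zero => simp
  | succ i ih =>
    rw [pow_succ, Module.End.mul_apply]
    cases j with
    | zero => simp [down_single_zero]
    | succ j => rw [down_single_succ, ih]; simp

theorem shift_single (i j m : ℕ) (r : R) :
    (up R ^ i * down R ^ j - up R ^ (i + 1) * down R ^ (j + 1)) (Finsupp.single m r) =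
      if j = m then Finsupp.single i r else 0 := by
  rw [LinearMap.sub_apply, Module.End.mul_apply, Module.End.mul_apply, down_pow_single,
    down_pow_single]
  rcases lt_trichotomy j m with h | h | h
  · rw [if_pos h.le, if_pos (Nat.succ_le_of_lt h), if_neg h.ne, up_pow_single, up_pow_single,
      show m - (j + 1) + (i + 1) = m - j + i by omega, sub_self]
  · subst h
    rw [if_pos le_rfl, if_neg (by omega), if_pos rfl, up_pow_single]
    simp
  · rw [if_neg (by omega), if_neg (by omega), if_neg h.ne']
    simp

end shifts

/-- The homomorphism from `S_2` to the column-finite matrices over `S_1` under which `x_1`, `y_1`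
act as shifts and `S_1(2)` as scalar matrices. It maps `s(2) E_{ij}(1)` to the matrix with the
single nonzero entry `s` in position `(i, j)`. -/
def toMat : S K 2 →ₐ[K] ColFin (S K 1) :=
  lift ![up (S K 1), diag (x 0)] ![down (S K 1), diag (y 0)]
    (fun i => by
      fin_cases i
      · exact down_mul_up
      · exact (diag_mul _ _).symm.trans ((congrArg diag (y_mul_x 0)).trans diag_one))
    (fun i j h => by
      fin_cases i <;> fin_cases j
      · exact absurd rfl h
      · exact up_mul_diag _
      · exact (down_mul_diag _).symm
      · exact absurd rfl h)
    (fun i j h => by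
      fin_cases i <;> fin_cases j
      · exact absurd rfl h
      · exact up_mul_diag _
      · exact (up_mul_diag _).symm
      · exact absurd rfl h)
    (fun i j h => by
      fin_cases i <;> fin_cases j
      · exact absurd rfl h
      · exact down_mul_diag _
      · exact (down_mul_diag _).symm
      · exact absurd rfl h)

theorem toMat_incl_one (s : S K 1) : toMat (incl (1 : Fin 2) s) = diag s := by
  let T : Subalgebra K (S K 1) :=
    { carrier := {s | toMat (incl (1 : Fin 2) s) = diag s}
      mul_mem' := by
        intro a b ha hb
        simp only [Set.mem_ofPred_eq] at *
        rw [map_mul, map_mul, ha, hb, diag_mul]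
      add_mem' := by
        intro a b ha hb
        simp only [Set.mem_ofPred_eq] at *
        rw [map_add, map_add, ha, hb]
        exact (map_add (Module.toModuleEnd (S K 1)ᵐᵒᵖ (ℕ →₀ S K 1)) a b).symm
      algebraMap_mem' := by
        intro c
        simp only [Set.mem_ofPred_eq]
        rw [AlgHom.commutes, AlgHom.commutes]
        refine colFin_ext fun j r => ?_
        rw [diag_single, Module.algebraMap_end_apply, Finsupp.smul_single, Algebra.smul_def] }
  have h : s ∈ T := mem_of_generators T
    (fun i => by
      change toMat (incl (1 : Fin 2) (x i)) = diag (x i)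
      rw [incl_x, Subsingleton.elim i 0]
      simp [toMat])
    (fun i => by
      change toMat (incl (1 : Fin 2) (y i)) = diag (y i)
      rw [incl_y, Subsingleton.elim i 0]
      simp [toMat]) s
  exact h

theorem entry_toMat (i j : ℕ) (s : S K 1) (a b : ℕ) :
    entry (toMat (E (0 : Fin 2) i j * incl (1 : Fin 2) s)) a b =
      if i = a ∧ j = b then s else 0 := by
  have h : toMat (E (0 : Fin 2) i j : S K 2) =
      up (S K 1) ^ i * down (S K 1) ^ j - up (S K 1) ^ (i + 1) * down (S K 1) ^ (j + 1) := by
    simp [E, toMat]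
  rw [map_mul, h, toMat_incl_one, entry, Module.End.mul_apply, diag_single, mul_one, shift_single]
  split_ifs with h1 h2 h3 <;> simp_all

theorem E_mul_incl_mem_p1 (i j : ℕ) (s : S K 1) :
    E (0 : Fin 2) i j * incl (1 : Fin 2) s ∈ p1 K := by
  refine Submodule.mul_mem_mul ⟨E 0 i j, Submodule.subset_span ⟨(i, j), rfl⟩, incl_E _ _ _⟩
    ⟨s, trivial, rfl⟩

/-- Induction on the elements of `𝔭_1`. -/
theorem p1_induction {P : S K 2 → Prop}
    (hE : ∀ i j s, P (E (0 : Fin 2) i j * incl (1 : Fin 2) s)) (h0 : P 0)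
    (hadd : ∀ u v, P u → P v → P (u + v)) {u : S K 2} (hu : u ∈ p1 K) : P u := by
  refine Submodule.mul_induction_on (C := P) hu ?_ hadd
  rintro _ ⟨f, hf, rfl⟩ _ ⟨s, -, rfl⟩
  change P (incl 0 f * incl 1 s)
  have hf' : f ∈ Submodule.span K (Set.range fun p : ℕ × ℕ => (E 0 p.1 p.2 : S K 1)) := hf
  clear hf
  induction hf' using Submodule.span_induction generalizing s with
  | mem f hf => obtain ⟨p, rfl⟩ := hf; rw [incl_E]; exact hE _ _ _
  | zero => simpa using h0
  | add f g _ _ hf hg => rw [map_add, add_mul]; exact hadd _ _ (hf s) (hg s)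
  | smul c f _ hf =>
    have : incl (0 : Fin 2) (c • f) * incl 1 s = incl 0 f * incl 1 (c • s) := by simp
    rw [this]
    exact hf _

theorem toMat_mem {u : S K 2} (hu : u ∈ p1 K) : toMat u ∈ MInf (S K 1) := by
  refine p1_induction (P := fun u => toMat u ∈ MInf (S K 1)) (fun i j s => ?_) ?_ ?_ hu
  · refine ⟨max i j + 1, fun a b hab => ?_⟩
    rw [entry_toMat, if_neg]
    omega
  · simp [(MInf (S K 1)).zero_mem]
  · intro u v hu hv
    rw [map_add]
    exact (MInf (S K 1)).add_mem hu hv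

theorem eq_sum_of_mem_p1 {u : S K 2} (hu : u ∈ p1 K) : ∃ d, ∀ e, d ≤ e →
    u = ∑ i ∈ Finset.range e, ∑ j ∈ Finset.range e,
      E (0 : Fin 2) i j * incl (1 : Fin 2) (entry (toMat u) i j) := by
  refine p1_induction (P := fun u => ∃ d, ∀ e, d ≤ e →
    u = ∑ i ∈ Finset.range e, ∑ j ∈ Finset.range e,
      E (0 : Fin 2) i j * incl (1 : Fin 2) (entry (toMat u) i j)) (fun i j s => ?_) ?_ ?_ hu
  · refine ⟨max i j + 1, fun e he => ?_⟩
    rw [Finset.sum_eq_single i, Finset.sum_eq_single j]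
    · rw [entry_toMat, if_pos ⟨rfl, rfl⟩]
    · intro b _ hb
      rw [entry_toMat, if_neg (fun h => hb h.2.symm), map_zero, mul_zero]
    · intro h
      exact absurd (Finset.mem_range.2 (by omega)) h
    · intro a _ ha
      refine Finset.sum_eq_zero fun b _ => ?_
      rw [entry_toMat, if_neg (fun h => ha h.1.symm), map_zero, mul_zero]
    · intro h
      exact absurd (Finset.mem_range.2 (by omega)) h
  · exact ⟨0, fun e _ => by simp⟩
  · rintro u v ⟨d, hd⟩ ⟨d', hd'⟩
    refine ⟨max d d', fun e he => ?_⟩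
    conv_lhs => rw [hd e (by omega), hd' e (by omega)]
    simp only [map_add, entry_add, mul_add, Finset.sum_add_distrib]

theorem toMat_injOn {u : S K 2} (hu : u ∈ p1 K) (h : toMat u = 0) : u = 0 := by
  obtain ⟨d, hd⟩ := eq_sum_of_mem_p1 hu
  rw [hd d le_rfl, h]
  simp

theorem toMat_surjOn {f : ColFin (S K 1)} (hf : f ∈ MInf (S K 1)) :
    ∃ u ∈ p1 K, toMat u = f := by
  obtain ⟨d, hd⟩ := hf
  refine ⟨∑ i ∈ Finset.range d, ∑ j ∈ Finset.range d,
      E (0 : Fin 2) i j * incl (1 : Fin 2) (entry f i j),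
    sum_mem fun i _ => sum_mem fun j _ => E_mul_incl_mem_p1 _ _ _, ?_⟩
  refine ColFin.ext_entry fun a b => ?_
  have e : ∀ g : ColFin (S K 1), entry g a b = entryHom a b g := fun _ => rfl
  rw [e, map_sum, map_sum]
  simp only [map_sum]
  simp only [← e, entry_toMat]
  by_cases hab : d ≤ a ∨ d ≤ b
  · rw [hd a b hab]
    refine Finset.sum_eq_zero fun i hi => Finset.sum_eq_zero fun j hj => if_neg ?_
    rw [Finset.mem_range] at hi hj
    omega
  · rw [Finset.sum_eq_single a, Finset.sum_eq_single b, if_pos ⟨rfl, rfl⟩]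
    · exact fun j _ hj => if_neg fun h => hj h.2
    · exact fun h => absurd (Finset.mem_range.2 (by omega)) h
    · exact fun i _ hi => Finset.sum_eq_zero fun j _ => if_neg fun h => hi h.1
    · exact fun h => absurd (Finset.mem_range.2 (by omega)) h

theorem toMat_onePlusMap_bijective :
    Function.Bijective (onePlusMap (I := p1 K) (J := MInf (S K 1)) (toMat (K := K)).toRingHom
      (fun _ h => toMat_mem h)) :=
  onePlusMap_bijective _ _ (fun _ hu h => toMat_injOn hu h) (fun _ hf => toMat_surjOn hf)

variable (K) in
/-- The canonical isomorphism `GL_∞(S_1) ≃ (1 + 𝔭_1)^*`,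
`1 + ∑ a_{ij} E_{ij} ↦ 1 + ∑ a_{ij}(2) E_{ij}(1)`. -/
def glEquiv : GLInf (S K 1) ≃* onePlusUnits (p1 K) :=
  (MulEquiv.ofBijective _ toMat_onePlusMap_bijective).symm

/-! ### The determinant on `(1 + F_2)^*` -/

/-- `K`-linear endomorphisms of `⨁_{i ∈ ℕ} e_i K`, viewed as column-finite matrices over `K`. -/
def toColFin : Module.End K (ℕ →₀ K) →+* ColFin K where
  toFun f :=
    { toFun := f
      map_add' := map_add f
      map_smul' := fun c v => by
        have h : ∀ w : ℕ →₀ K, c • w = c.unop • w := fun w => by ext i; simp [mul_comm]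
        rw [h, map_smul]; exact (h _).symm }
  map_one' := rfl
  map_mul' _ _ := rfl
  map_zero' := rfl
  map_add' _ _ := rfl

/-- The linear isomorphism `P_2 ≃ ⨁_{i ∈ ℕ} e_i K`, `x^α ↦ e_{b(α)}`, given by a bijection
`b : ℕ² → ℕ`. -/
def enumBasis (b : (Fin 2 →₀ ℕ) ≃ ℕ) : MvPolynomial (Fin 2) K ≃ₗ[K] (ℕ →₀ K) :=
  (MvPolynomial.basisMonomials (Fin 2) K).repr.trans (Finsupp.domLCongr b)

/-- The matrix of the action of an element of `S_2` on `P_2` in the basis of monomials, enumerated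
by `b`. It maps `E_{αβ}` to the matrix unit `E_{b(α) b(β)}`. -/
def enumMat (b : (Fin 2 →₀ ℕ) ≃ ℕ) : S K 2 →+* ColFin K :=
  (toColFin.comp (enumBasis b).conjRingEquiv.toRingHom).comp (act (K := K) (n := 2)).toRingHom

theorem enumBasis_apply (b : (Fin 2 →₀ ℕ) ≃ ℕ) (p : MvPolynomial (Fin 2) K) (i : ℕ) :
    enumBasis b p i = coeff (b.symm i) p := rfl

theorem entry_enumMat (b : (Fin 2 →₀ ℕ) ≃ ℕ) (z : S K 2) (i j : ℕ) :
    entry (enumMat b z) i j = coeff (b.symm i) (act z (monomial (b.symm j) 1)) := by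
  have h : (enumBasis b).symm (Finsupp.single j (1 : K)) = monomial (b.symm j) 1 := by
    rw [LinearEquiv.symm_apply_eq]
    ext l
    rw [enumBasis_apply, coeff_monomial, Finsupp.single_apply]
    simp only [b.symm.injective.eq_iff]
  have e : entry (enumMat b z) i j =
      enumBasis b (act z ((enumBasis b).symm (Finsupp.single j 1))) i := rfl
  rw [e, h, enumBasis_apply]

theorem lower_monomial (k : Fin n) (m : Fin n →₀ ℕ) (r : K) :
    lower k (monomial m r) = if 1 ≤ m k then monomial (m - Finsupp.single k 1) r else 0 := by
  ext l
  rw [coeff_lower, coeff_monomial]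
  by_cases h : 1 ≤ m k
  · rw [if_pos h, coeff_monomial]
    refine if_congr ⟨fun e => ?_, fun e => ?_⟩ rfl rfl
    · rw [e, add_tsub_cancel_left]
    · rw [← e, add_tsub_cancel_of_le (Finsupp.single_le_iff.2 h)]
  · rw [if_neg h, coeff_zero, if_neg]
    intro e
    apply h
    rw [e]
    simp

theorem lower_pow_monomial (k : Fin n) (j : ℕ) (m : Fin n →₀ ℕ) (r : K) :
    (lower k ^ j) (monomial m r) =
      if j ≤ m k then monomial (m - Finsupp.single k j) r else 0 := by
  induction j generalizing m with
  | zero => simp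
  | succ j ih =>
    rw [pow_succ, Module.End.mul_apply, lower_monomial]
    by_cases h : 1 ≤ m k
    · rw [if_pos h, ih]
      have e : m - Finsupp.single k 1 - Finsupp.single k j = m - Finsupp.single k (j + 1) := by
        rw [tsub_tsub, ← Finsupp.single_add, add_comm 1 j]
      rw [e]
      refine if_congr ?_ rfl rfl
      simp only [Finsupp.tsub_apply, Finsupp.single_eq_same]
      omega
    · rw [if_neg h, map_zero, if_neg (by omega)]

theorem raise_pow_monomial (k : Fin n) (i : ℕ) (m : Fin n →₀ ℕ) (r : K) :
    (LinearMap.mulLeft K (X k : MvPolynomial (Fin n) K) ^ i) (monomial m r) =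
      monomial (m + Finsupp.single k i) r := by
  rw [LinearMap.pow_mulLeft, LinearMap.mulLeft_apply, X_pow_eq_monomial, monomial_mul, one_mul,
    add_comm]

theorem act_E_monomial (k : Fin n) (i j : ℕ) (m : Fin n →₀ ℕ) (r : K) :
    act (E k i j) (monomial m r) = if j = m k then monomial (m.update k i) r else 0 := by
  have h : act (E k i j : S K n) =
      LinearMap.mulLeft K (X k) ^ i * lower k ^ j -
        LinearMap.mulLeft K (X k) ^ (i + 1) * lower k ^ (j + 1) := by
    simp [E, act]
  rw [h, LinearMap.sub_apply, Module.End.mul_apply, Module.End.mul_apply, lower_pow_monomial,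
    lower_pow_monomial]
  rcases lt_trichotomy j (m k) with h | h | h
  · rw [if_pos h.le, if_pos (Nat.succ_le_of_lt h), if_neg h.ne, raise_pow_monomial,
      raise_pow_monomial, sub_eq_zero]
    refine congrArg (fun q => monomial q r) (Finsupp.ext fun t => ?_)
    simp only [Finsupp.add_apply, Finsupp.tsub_apply, Finsupp.single_apply]
    split_ifs with ht
    · subst ht; omega
    · rfl
  · rw [if_pos h.le, if_neg (by omega), if_pos h, raise_pow_monomial, map_zero, sub_zero]
    refine congrArg (fun q => monomial q r) (Finsupp.ext fun t => ?_)
    simp only [Finsupp.add_apply, Finsupp.tsub_apply, Finsupp.single_apply, Finsupp.update_apply]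
    by_cases ht : k = t
    · subst ht; simp [h]
    · simp [ht, Ne.symm ht]
  · rw [if_neg (by omega), if_neg (by omega), if_neg h.ne']
    simp

/-- Induction on the elements of `F_2`. -/
theorem F2_induction {P : S K 2 → Prop}
    (hE : ∀ (c : K) (i j i' j' : ℕ), P (c • (E (0 : Fin 2) i j * E (1 : Fin 2) i' j'))) (h0 : P 0)
    (hadd : ∀ u v, P u → P v → P (u + v)) {u : S K 2} (hu : u ∈ F2 K) : P u := by
  have hu' : u ∈ (F K).map (incl (0 : Fin 2)).toLinearMap *
    (F K).map (incl (1 : Fin 2)).toLinearMap := hu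
  rw [F, Submodule.map_span, Submodule.map_span, Submodule.span_mul_span] at hu'
  clear hu
  induction hu' using Submodule.closure_induction with
  | zero => exact h0
  | add u v _ _ hu hv => exact hadd u v hu hv
  | smul_mem c u hu =>
    obtain ⟨_, ⟨_, ⟨p, rfl⟩, rfl⟩, _, ⟨_, ⟨q, rfl⟩, rfl⟩, rfl⟩ := hu
    have := hE c p.1 p.2 q.1 q.2
    rw [← incl_E (0 : Fin 2), ← incl_E (1 : Fin 2)] at this
    exact this

theorem enumMat_mem (b : (Fin 2 →₀ ℕ) ≃ ℕ) {u : S K 2} (hu : u ∈ F2 K) :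
    enumMat b u ∈ MInf K := by
  refine F2_induction (P := fun u => enumMat b u ∈ MInf K) (fun c i j i' j' => ?_) ?_ ?_ hu
  · let α : Fin 2 →₀ ℕ := Finsupp.single 0 i + Finsupp.single 1 i'
    let β : Fin 2 →₀ ℕ := Finsupp.single 0 j + Finsupp.single 1 j'
    refine ⟨max (b α) (b β) + 1, fun s t hst => ?_⟩
    rw [entry_enumMat, map_smul, map_mul, LinearMap.smul_apply, Module.End.mul_apply,
      act_E_monomial, coeff_smul]
    split_ifs with h1
    · rw [act_E_monomial]
      split_ifs with h2
      · have ht : b.symm t = β := by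
          ext l
          fin_cases l
          · simpa [β, Finsupp.update_apply] using h2.symm
          · simpa [β] using h1.symm
        have hs : (((b.symm t).update 1 i').update 0 i) = α := by
          ext l
          fin_cases l <;> simp [α, Finsupp.update_apply]
        rw [hs, coeff_monomial, if_neg, smul_zero]
        intro h
        have h3 : s = b α := by rw [h]; simp
        have h4 : t = b β := by rw [← ht]; simp
        omega
      · simp
    · simp
  · simp [(MInf K).zero_mem]
  · intro u v hu hv
    rw [map_add]
    exact (MInf K).add_mem hu hv

/-- The determinant `(1 + F_2)^* → K^*` obtained from the determinant of `GL_∞(K)` through the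
isomorphism `(1 + F_2)^* ≃ GL_∞(K)`, `1 + ∑ λ_{αβ} E_{αβ} ↦ 1 + ∑ λ_{αβ} E_{b(α) b(β)}`,
given by a bijection `b : ℕ² → ℕ`. -/
def det (b : (Fin 2 →₀ ℕ) ≃ ℕ) : onePlusUnits (F2 K) →* Kˣ :=
  (detGLInf K).comp (onePlusMap (I := F2 K) (J := MInf K) (enumMat b) (fun _ h => enumMat_mem b h))

/-- The group `SL = {u ∈ (1 + F_2)^* | det(u) = 1}`, as a subgroup of the group of units of
`S_2`. -/
def SL (b : (Fin 2 →₀ ℕ) ≃ ℕ) : Subgroup (S K 2)ˣ :=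
  (det b).ker.map (onePlusUnits (F2 K)).subtype

end S

end Alg

end OneSided

end

namespace OneSided

/-! In the monomial basis of $P_2$, enumerated by `b`, each element of $\mathbb{S}_2$ becomes a
column-finite matrix (`enumMat`), and $F_2$ is carried into $M_\infty(K)$. Both invariance
statements are then facts about matrices $1+f$ with $f$ finite.

Conjugation: if $c$ is an invertible column-finite matrix and $1+g=c(1+f)c^{-1}$ with $f,g$ both
finite, put $t=fc^{-1}=c^{-1}g$. The first expression shows that $t$ has finitely many nonzero rows,
the second that it has finitely many nonzero columns. So $g=ct$ and $f=tc$ remain products after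
truncation to a large block, and $\det(1+AB)=\det(1+BA)$ gives equality of determinants
(`detGLInf_conj`). That $g$ comes from $F_2$ again holds because $F_2$ is a two-sided ideal of
$\mathbb{S}_2$ (`mul_mem_F2_left`, `mul_mem_F2_right`). The result is invariance under conjugation
by every unit of $\mathbb{S}_2$ (`det_conj`), in particular by $(1+\mathfrak{p}_1)^*$.

Involution: $\eta(E_{ij}(k))=E_{ji}(k)$, so $\eta$ transposes the matrices of $F_2$
(`entry_enumMat_eta`), which preserves determinants.

Normality: by invariance, $aua^{-1}u^{-1}$ has determinant $1$, so it lies in $\mathrm{SL}$ and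
hence in any $N\supseteq\mathrm{SL}$; therefore $aua^{-1}\in N$ for $u\in N$ (`normal_of_SL_le`). -/

theorem conj_sub_one {A : Type*} [Ring A] (c : Aˣ) (a : A) :
    (c : A) * ((a - 1) * (c⁻¹ : Aˣ)) = c * a * (c⁻¹ : Aˣ) - 1 := by
  rw [sub_mul, mul_sub, one_mul, Units.mul_inv, mul_assoc]

/-! ### Determinants on $\mathrm{GL}_\infty$: conjugation and transposition. -/

section Det

variable {k : Type*} [CommRing k]

theorem entry_mul_of_col {d : ℕ} {f : ColFin k} (hf : ∀ i j, d ≤ j → entry f i j = 0)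
    (g : ColFin k) (i j : ℕ) :
    entry (f * g) i j = ∑ l ∈ Finset.range d, entry f i l * entry g l j := by
  -- The support of column `j` of `g` and `range d` need not be comparable, so both sums are
  -- extended to the union: outside the support `g` contributes zero, outside `range d` the matrix
  -- `f` does.
  rw [entry_mul, Finsupp.sum, Finset.sum_subset
    (Finset.subset_union_left (s₂ := Finset.range d))]
  · refine (Finset.sum_subset Finset.subset_union_right fun l _ hl => ?_).symm
    rw [hf i l (by simpa using hl), zero_mul]
  · intro l _ hl
    rw [Finsupp.notMem_support_iff.1 hl, mul_zero]

theorem entry_mul_of_row {d : ℕ} {g : ColFin k} (hg : ∀ i j, d ≤ i → entry g i j = 0)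
    (f : ColFin k) (i j : ℕ) :
    entry (f * g) i j = ∑ l ∈ Finset.range d, entry f i l * entry g l j := by
  rw [entry_mul]
  refine Finsupp.sum_of_support_subset _ (fun l hl => ?_) _ (by simp)
  rw [Finset.mem_range]
  by_contra hd
  exact (Finsupp.mem_support_iff.1 hl) (hg l j (not_lt.1 hd))

theorem block_eq_one_add (d : ℕ) (f : ColFin k) : block d f = 1 + block d (f - 1) := by
  ext i j
  simp [block, entry_one, Matrix.one_apply, Fin.ext_iff]

/-- The determinant of a matrix in `GL_∞(k)` is invariant under conjugation by arbitrary
invertible column-finite matrices. -/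
theorem detGLInf_conj (c : (ColFin k)ˣ) (u v : GLInf k)
    (h : (v : (ColFin k)ˣ) = c * (u : (ColFin k)ˣ) * c⁻¹) : detGLInf k v = detGLInf k u := by
  obtain ⟨d₁, hd₁⟩ := u.2.1
  obtain ⟨d₂, hd₂⟩ := v.2.1
  have hu := hd₁.mono (le_max_left d₁ d₂)
  have hv := hd₂.mono (le_max_right d₁ d₂)
  generalize max d₁ d₂ = d at hu hv
  refine Units.ext ?_
  rw [detGLInf_eq v hv, detGLInf_eq u hu, block_eq_one_add d ((u : (ColFin k)ˣ) : ColFin k),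
    block_eq_one_add d ((v : (ColFin k)ˣ) : ColFin k)]
  set f : ColFin k := ((u : (ColFin k)ˣ) : ColFin k) - 1 with hf
  set g : ColFin k := ((v : (ColFin k)ˣ) : ColFin k) - 1 with hg
  -- The common factor: `f = t * c` and `g = c * t`. Rows of `c⁻¹` may be infinite, so finiteness of
  -- the columns of `t` is not visible from this definition; it comes from the other expression `c⁻¹
  -- * g`.
  set t : ColFin k := f * ((c⁻¹ : (ColFin k)ˣ) : ColFin k) with ht
  have hct : (c : ColFin k) * t = g := by
    rw [ht, hf, hg, h]
    exact conj_sub_one (A := ColFin k) c _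
  have htc : t * (c : ColFin k) = f := by rw [ht, mul_assoc, Units.inv_mul, mul_one]
  have hcg : ((c⁻¹ : (ColFin k)ˣ) : ColFin k) * g = t := by
    rw [← hct, ← mul_assoc, Units.inv_mul, one_mul]
  have hrow : ∀ i j, d ≤ i → entry t i j = 0 := fun i j hi => by
    rw [ht, entry_mul_of_col (fun i j hj => hu i j (Or.inr hj))]
    exact Finset.sum_eq_zero fun l _ => by rw [hu i l (Or.inl hi), zero_mul]
  have hcol : ∀ i j, d ≤ j → entry t i j = 0 := fun i j hj => by
    rw [← hcg, entry_mul_of_row (fun i j hi => hv i j (Or.inl hi))]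
    exact Finset.sum_eq_zero fun l _ => by rw [hv l j (Or.inr hj), mul_zero]
  have e1 : block d g = block d (c : ColFin k) * block d t := by
    ext i j
    rw [← hct, Matrix.mul_apply]
    exact (entry_mul_of_row hrow _ _ _).trans (Fin.sum_univ_eq_sum_range
      (fun l => entry (c : ColFin k) i l * entry t l j) d).symm
  have e2 : block d f = block d t * block d (c : ColFin k) := by
    ext i j
    rw [← htc, Matrix.mul_apply]
    exact (entry_mul_of_col hcol _ _ _).trans (Fin.sum_univ_eq_sum_range
      (fun l => entry t i l * entry (c : ColFin k) l j) d).symm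
  -- The truncation of `c` need not be invertible, so the blocks need not be conjugate by it;
  -- Sylvester's identity requires no invertibility.
  rw [e1, e2, Matrix.det_one_add_mul_comm]

/-- Transposition is expressed entrywise because it does not preserve column-finiteness in general.
-/
theorem detGLInf_transpose (u v : GLInf k) (h : ∀ i j,
    entry ((v : (ColFin k)ˣ) : ColFin k) i j = entry ((u : (ColFin k)ˣ) : ColFin k) j i) :
    detGLInf k v = detGLInf k u := by
  obtain ⟨d₁, hd₁⟩ := u.2.1
  obtain ⟨d₂, hd₂⟩ := v.2.1
  refine Units.ext ?_
  rw [detGLInf_eq v (hd₂.mono (le_max_right d₁ d₂)), detGLInf_eq u (hd₁.mono (le_max_left d₁ d₂)),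
    ← Matrix.det_transpose]
  congr 1
  ext i j
  exact h _ _

end Det

namespace S

open MvPolynomial

variable {K : Type*} [Field K] {n : ℕ}

/-! ### $F_2$ as a two-sided ideal stable under the involution. -/

/-- `F2` is packaged as a non-unital subring, which forgets scalars; the submodule it is built from
still has them. -/
theorem smul_mem_F2 (c : K) {z : S K 2} (hz : z ∈ F2 K) : c • z ∈ F2 K :=
  Submodule.smul_mem ((F K).map (incl (0 : Fin 2)).toLinearMap *
    (F K).map (incl (1 : Fin 2)).toLinearMap) c hz

theorem E_mem_F2 (c : K) (i j i' j' : ℕ) :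
    c • ((E (0 : Fin 2) i j : S K 2) * E (1 : Fin 2) i' j') ∈ F2 K :=
  smul_mem_F2 c <| Submodule.mul_mem_mul
    (M := (F K).map (incl (0 : Fin 2)).toLinearMap) (N := (F K).map (incl (1 : Fin 2)).toLinearMap)
    ⟨E 0 i j, Submodule.subset_span ⟨(i, j), rfl⟩, incl_E _ _ _⟩
    ⟨E 0 i' j', Submodule.subset_span ⟨(i', j'), rfl⟩, incl_E _ _ _⟩

theorem F2_le_p1 : F2 K ≤ p1 K := fun _ hz => (mul_le_mul' le_rfl (Submodule.map_mono le_top)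
  : (F K).map (incl (0 : Fin 2)).toLinearMap * (F K).map (incl (1 : Fin 2)).toLinearMap ≤ _) hz

theorem E_commute (i j i' j' : ℕ) :
    Commute (E (0 : Fin 2) i j : S K 2) (E (1 : Fin 2) i' j') := by
  rw [← incl_E, ← incl_E (1 : Fin 2)]
  exact incl_commute _ _

/-- With the two lemmas that follow, this is why $F_2$ is a left ideal: the generators merely move
the row index of a matrix unit, with $E_{-1,j}=0$. -/
theorem x_mul_E (k : Fin n) (i j : ℕ) : (x k : S K n) * E k i j = E k (i + 1) j := by
  simp only [E, mul_sub, pow_succ' (x k), mul_assoc]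

theorem y_mul_E_succ (k : Fin n) (i j : ℕ) : (y k : S K n) * E k (i + 1) j = E k i j := by
  rw [← x_mul_E, ← mul_assoc, y_mul_x, one_mul]

theorem y_mul_E_zero (k : Fin n) (j : ℕ) : (y k : S K n) * E k 0 j = 0 := by
  simp only [E, mul_sub, pow_zero, one_mul, zero_add, pow_one]
  rw [← mul_assoc, y_mul_x, one_mul, ← pow_succ', sub_self]

theorem unop_eta_x (k : Fin n) : (eta (x k : S K n)).unop = y k := by simp [eta]

theorem unop_eta_y (k : Fin n) : (eta (y k : S K n)).unop = x k := by simp [eta]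

theorem unop_eta_E (k : Fin n) (i j : ℕ) : (eta (E k i j : S K n)).unop = E k j i := by
  simp [E, unop_eta_x, unop_eta_y]

theorem unop_eta_unop_eta (z : S K n) : (eta (eta z).unop).unop = z := by
  -- Passing through the double opposite algebra makes $\eta\circ\eta$ an algebra endomorphism, so
  -- that it is determined by its values on generators.
  let φ : S K n →ₐ[K] S K n :=
    (AlgEquiv.opOp K (S K n)).symm.toAlgHom.comp ((AlgHom.op eta).comp eta)
  have h : φ = AlgHom.id K (S K n) := algHom_ext
    (fun i => by
      change (eta (eta (x i)).unop).unop = x i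
      rw [unop_eta_x, unop_eta_y])
    (fun i => by
      change (eta (eta (y i)).unop).unop = y i
      rw [unop_eta_y, unop_eta_x])
  exact congrArg (fun g : S K n →ₐ[K] S K n => g z) h

/-- An anti-automorphism reverses the product, but the two factors involve different variables and
commute, so the order is restored. -/
theorem unop_eta_E_mul_E (c : K) (i j i' j' : ℕ) :
    (eta (c • ((E (0 : Fin 2) i j : S K 2) * E (1 : Fin 2) i' j'))).unop =
      c • (E (0 : Fin 2) j i * E (1 : Fin 2) j' i') := by
  rw [map_smul, map_mul, MulOpposite.unop_smul, MulOpposite.unop_mul, unop_eta_E, unop_eta_E,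
    (E_commute _ _ _ _).eq]

theorem eta_mem_F2 {z : S K 2} (hz : z ∈ F2 K) : (eta z).unop ∈ F2 K := by
  refine F2_induction (P := fun z => (eta z).unop ∈ F2 K) (fun c i j i' j' => ?_) ?_ ?_ hz
  · rw [unop_eta_E_mul_E]
    exact E_mem_F2 _ _ _ _ _
  · simp [(F2 K).zero_mem]
  · intro u v hu hv
    rw [map_add, MulOpposite.unop_add]
    exact (F2 K).add_mem hu hv

theorem generator_mul_mem_F2 (g : S K 2)
    (hg : ∀ i j i' j' : ℕ, g * (E (0 : Fin 2) i j * E (1 : Fin 2) i' j') ∈ F2 K)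
    {z : S K 2} (hz : z ∈ F2 K) : g * z ∈ F2 K := by
  refine F2_induction (P := fun z => g * z ∈ F2 K) (fun c i j i' j' => ?_) ?_ ?_ hz
  · rw [mul_smul_comm]
    exact smul_mem_F2 c (hg i j i' j')
  · simp [(F2 K).zero_mem]
  · intro u v hu hv
    rw [mul_add]
    exact (F2 K).add_mem hu hv

/-- The elements that map $F_2$ into itself by left multiplication form a subalgebra, so only the
generators $x_k$, $y_k$ have to be tested. -/
theorem mul_mem_F2_left (a : S K 2) {z : S K 2} (hz : z ∈ F2 K) : a * z ∈ F2 K := by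
  let T : Subalgebra K (S K 2) :=
    { carrier := {a | ∀ z ∈ F2 K, a * z ∈ F2 K}
      mul_mem' := fun {a b} ha hb z hz => by rw [mul_assoc]; exact ha _ (hb z hz)
      add_mem' := fun {a b} ha hb z hz => by rw [add_mul]; exact (F2 K).add_mem (ha z hz) (hb z hz)
      algebraMap_mem' := fun c z hz => by
        rw [← Algebra.smul_def]
        exact smul_mem_F2 c hz }
  have hE : ∀ i j i' j' : ℕ, (E (0 : Fin 2) i j : S K 2) * E (1 : Fin 2) i' j' ∈ F2 K :=
    fun i j i' j' => by simpa using E_mem_F2 (1 : K) i j i' j'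
  refine mem_of_generators T (fun k z hz => generator_mul_mem_F2 _ (fun i j i' j' => ?_) hz)
    (fun k z hz => generator_mul_mem_F2 _ (fun i j i' j' => ?_) hz) a z hz
  · fin_cases k
    · change x 0 * _ ∈ _
      rw [← mul_assoc, x_mul_E]
      exact hE _ _ _ _
    · change x 1 * _ ∈ _
      -- The factor in the second variable is brought to the front to meet the generator, and moved
      -- back afterwards.
      rw [(E_commute _ _ _ _).eq, ← mul_assoc, x_mul_E, ← (E_commute _ _ _ _).eq]
      exact hE _ _ _ _
  · fin_cases k
    · change y 0 * _ ∈ _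
      cases i with
      | zero => rw [← mul_assoc, y_mul_E_zero, zero_mul]; exact (F2 K).zero_mem
      | succ i => rw [← mul_assoc, y_mul_E_succ]; exact hE _ _ _ _
    · change y 1 * _ ∈ _
      rw [(E_commute _ _ _ _).eq, ← mul_assoc]
      cases i' with
      | zero => rw [y_mul_E_zero, zero_mul]; exact (F2 K).zero_mem
      | succ i' => rw [y_mul_E_succ, ← (E_commute _ _ _ _).eq]; exact hE _ _ _ _

/-- Since $za=\eta(\eta(a)\eta(z))$, the right-hand case reduces to the left-hand one by stability
of $F_2$ under $\eta$. -/
theorem mul_mem_F2_right (a : S K 2) {z : S K 2} (hz : z ∈ F2 K) : z * a ∈ F2 K := by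
  have h := eta_mem_F2 (mul_mem_F2_left (eta a).unop (eta_mem_F2 hz))
  rwa [map_mul, MulOpposite.unop_mul, unop_eta_unop_eta, unop_eta_unop_eta] at h

/-! ### Conjugation by units of $\mathbb{S}_2$. -/

theorem conj_sub_one_mem_F2 (a : (S K 2)ˣ) {z : S K 2} (hz : z - 1 ∈ F2 K) :
    a * z * (a⁻¹ : (S K 2)ˣ) - 1 ∈ F2 K := by
  have h := mul_mem_F2_right ((a⁻¹ : (S K 2)ˣ) : S K 2) (mul_mem_F2_left (a : S K 2) hz)
  rwa [mul_sub, sub_mul, mul_one, Units.mul_inv] at h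

/-- `(1 + F_2)^*` is a normal subgroup of the group of units of `S_2`. -/
instance onePlusUnits_F2_normal : (onePlusUnits (F2 K)).Normal where
  conj_mem u hu a := by
    refine ⟨conj_sub_one_mem_F2 a hu.1, ?_⟩
    have h := conj_sub_one_mem_F2 a hu.2
    simpa [mul_assoc] using h

/-- `enumMat b` is a ring homomorphism on all of $\mathbb{S}_2$, so `a` becomes an invertible
column-finite matrix, in general outside $\mathrm{GL}_\infty(K)$; this is why `detGLInf_conj` admits
such conjugators. -/
theorem det_conj (b : (Fin 2 →₀ ℕ) ≃ ℕ) (a : (S K 2)ˣ) (u v : onePlusUnits (F2 K))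
    (h : (v : (S K 2)ˣ) = a * u * a⁻¹) : det b v = det b u := by
  refine detGLInf_conj (Units.map (enumMat b).toMonoidHom a) _ _ ?_
  have := congrArg (Units.map (enumMat b).toMonoidHom) h
  rwa [map_mul, map_mul, map_inv] at this

/-! ### The involution as matrix transposition. -/

/-- The condition separates a row part from a column part, so that transposing amounts to swapping
the two conjuncts. -/
theorem entry_enumMat_E (b : (Fin 2 →₀ ℕ) ≃ ℕ) (i j i' j' s t : ℕ) :
    entry (enumMat b (E (0 : Fin 2) i j * E (1 : Fin 2) i' j' : S K 2)) s t =
      if ((b.symm s 0 = i ∧ b.symm s 1 = i') ∧ (b.symm t 0 = j ∧ b.symm t 1 = j'))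
        then (1 : K) else 0 := by
  rw [entry_enumMat, map_mul, Module.End.mul_apply, act_E_monomial]
  by_cases h1 : j' = b.symm t 1
  · rw [if_pos h1, act_E_monomial]
    by_cases h2 : j = b.symm t 0
    · rw [if_pos (by simpa [Finsupp.update_apply] using h2), coeff_monomial]
      refine if_congr ⟨fun h => ?_, fun h => ?_⟩ rfl rfl
      · rw [← h]
        simp [Finsupp.update_apply, h1, h2]
      · ext l
        fin_cases l <;> simp [Finsupp.update_apply, h.1]
    · rw [if_neg (by simpa [Finsupp.update_apply] using h2), coeff_zero,
        if_neg (fun h => h2 h.2.1.symm)]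
  · rw [if_neg h1, map_zero, coeff_zero, if_neg (fun h => h1 h.2.2.symm)]

theorem entry_enumMat_smul (b : (Fin 2 →₀ ℕ) ≃ ℕ) (c : K) (z : S K 2) (i j : ℕ) :
    entry (enumMat b (c • z)) i j = c * entry (enumMat b z) i j := by
  rw [entry_enumMat, entry_enumMat, map_smul, LinearMap.smul_apply, coeff_smul, smul_eq_mul]

/-- The involution `η` acts on `F_2` by transposition of matrices. -/
theorem entry_enumMat_eta (b : (Fin 2 →₀ ℕ) ≃ ℕ) {z : S K 2} (hz : z ∈ F2 K) (s t : ℕ) :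
    entry (enumMat b (eta z).unop) s t = entry (enumMat b z) t s := by
  refine F2_induction (P := fun z => entry (enumMat b (eta z).unop) s t = entry (enumMat b z) t s)
    (fun c i j i' j' => ?_) ?_ ?_ hz
  · rw [unop_eta_E_mul_E, entry_enumMat_smul, entry_enumMat_smul, entry_enumMat_E,
      entry_enumMat_E]
    simp only [and_comm]
  · simp
  · intro u v hu hv
    rw [map_add, MulOpposite.unop_add, map_add, map_add, entry_add, entry_add, hu, hv]

theorem unop_eta_sub_one_mem {z : S K 2} (hz : z - 1 ∈ F2 K) : (eta z).unop - 1 ∈ F2 K := by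
  have h := eta_mem_F2 hz
  rwa [map_sub, map_one, MulOpposite.unop_sub, MulOpposite.unop_one] at h

theorem etaUnit_mem {u : (S K 2)ˣ} (hu : u ∈ onePlusUnits (F2 K)) :
    etaUnit u ∈ onePlusUnits (F2 K) :=
  ⟨unop_eta_sub_one_mem hu.1, unop_eta_sub_one_mem hu.2⟩

theorem det_etaUnit (b : (Fin 2 →₀ ℕ) ≃ ℕ) (u : onePlusUnits (F2 K)) :
    det b ⟨etaUnit (u : (S K 2)ˣ), etaUnit_mem u.2⟩ = det b u := by
  refine detGLInf_transpose _ _ fun i j => ?_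
  change entry (enumMat b (eta (((u : (S K 2)ˣ) : S K 2))).unop) i j =
    entry (enumMat b ((u : (S K 2)ˣ) : S K 2)) j i
  -- Transposition is known on $F_2$ only, so it is applied to $u-1$; the identity matrix then
  -- cancels, being symmetric.
  have h := entry_enumMat_eta b u.2.1 i j
  rw [map_sub, map_one, MulOpposite.unop_sub, MulOpposite.unop_one, map_sub, map_sub, map_one,
    entry_sub, entry_sub, entry_one, entry_one] at h
  simpa only [eq_comm (a := i) (b := j), sub_left_inj] using h

/-! ### Normality of the groups between $\mathrm{SL}$ and $(1+F_2)^*$. -/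

theorem SL_le (b : (Fin 2 →₀ ℕ) ≃ ℕ) : SL b ≤ onePlusUnits (F2 K) := Subgroup.map_subtype_le _

theorem onePlusUnits_F2_le_p1 : onePlusUnits (F2 K) ≤ onePlusUnits (p1 K) :=
  fun _ hu => ⟨F2_le_p1 hu.1, F2_le_p1 hu.2⟩

/-- Every subgroup of `(1 + F_2)^*` containing `SL` is normal in the group of units of `S_2`. -/
theorem normal_of_SL_le (b : (Fin 2 →₀ ℕ) ≃ ℕ) {N : Subgroup (S K 2)ˣ} (h : SL b ≤ N)
    (hN : N ≤ onePlusUnits (F2 K)) : N.Normal where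
  conj_mem u hu a := by
    have hc := onePlusUnits_F2_normal.conj_mem u (hN hu) a
    have hdet := det_conj b a ⟨u, hN hu⟩ ⟨_, hc⟩ rfl
    -- The commutator is a product of two elements of $(1+F_2)^*$ with inverse determinants;
    -- multiplying it by $u\in N$ recovers the conjugate.
    have hmem : a * u * a⁻¹ * u⁻¹ ∈ SL b :=
      ⟨⟨_, hc⟩ * ⟨u, hN hu⟩⁻¹, by
        rw [SetLike.mem_coe, MonoidHom.mem_ker, map_mul, map_inv, hdet, mul_inv_cancel], rfl⟩
    have := N.mul_mem (h hmem) hu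
    rwa [inv_mul_cancel_right] at this

/-- Transfers normality from the full unit group of $\mathbb{S}_2$ to
$\mathrm{GL}_\infty(\mathbb{S}_1)$: it survives restriction to $(1+\mathfrak{p}_1)^*$ and pullback
along the identification. -/
theorem normal_comap_glEquiv {N : Subgroup (S K 2)ˣ} (hN : N.Normal) :
    ((N.subgroupOf (onePlusUnits (p1 K))).comap (glEquiv K).toMonoidHom).Normal :=
  inferInstance

end S

end OneSided

theorem mainTheorem6 (K : Type*) [Field K] (b : (Fin 2 →₀ ℕ) ≃ ℕ) :
    -- the determinant is invariant under the involution
    (∀ u : OneSided.onePlusUnits (OneSided.S.F2 K),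
      ∃ h : OneSided.S.etaUnit (u : (OneSided.S K 2)ˣ) ∈
          OneSided.onePlusUnits (OneSided.S.F2 K),
        OneSided.S.det b ⟨OneSided.S.etaUnit (u : (OneSided.S K 2)ˣ), h⟩ = OneSided.S.det b u) ∧
    -- invariance under conjugation by elements that preserve a filtration
    (∀ a : OneSided.GLInf (OneSided.S K 1),
      ∀ V : ℕ → Submodule K (MvPolynomial (Fin 2) K),
        Monotone V → (∀ i, FiniteDimensional K (V i)) → (∀ p, ∃ i, p ∈ V i) →
        (∀ᶠ i in Filter.atTop, ∀ p ∈ V i,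
          OneSided.S.act (((OneSided.S.glEquiv K a : (OneSided.S K 2)ˣ)) : OneSided.S K 2) p
            ∈ V i) →
        ∀ u : OneSided.onePlusUnits (OneSided.S.F2 K),
          ∃ h : (OneSided.S.glEquiv K a : (OneSided.S K 2)ˣ) * u *
              (OneSided.S.glEquiv K a : (OneSided.S K 2)ˣ)⁻¹ ∈
                OneSided.onePlusUnits (OneSided.S.F2 K),
            OneSided.S.det b ⟨_, h⟩ = OneSided.S.det b u) ∧
    -- invariance under conjugation by all elements
    (∀ a : OneSided.GLInf (OneSided.S K 1), ∀ u : OneSided.onePlusUnits (OneSided.S.F2 K),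
      ∃ h : (OneSided.S.glEquiv K a : (OneSided.S K 2)ˣ) * u *
          (OneSided.S.glEquiv K a : (OneSided.S K 2)ˣ)⁻¹ ∈
            OneSided.onePlusUnits (OneSided.S.F2 K),
        OneSided.S.det b ⟨_, h⟩ = OneSided.S.det b u) ∧
    -- `SL` is a normal subgroup of `GL_∞(S_1)`
    (OneSided.S.SL b ≤ OneSided.onePlusUnits (OneSided.S.p1 K) ∧
      (((OneSided.S.SL b).subgroupOf (OneSided.onePlusUnits (OneSided.S.p1 K))).comap
        (OneSided.S.glEquiv K).toMonoidHom).Normal) ∧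
    -- every subgroup between `SL` and `(1 + F_2)^*` is a normal subgroup of `GL_∞(S_1)`
    (∀ N : Subgroup (OneSided.S K 2)ˣ,
      OneSided.S.SL b ≤ N → N ≤ OneSided.onePlusUnits (OneSided.S.F2 K) →
        N ≤ OneSided.onePlusUnits (OneSided.S.p1 K) ∧
        ((N.subgroupOf (OneSided.onePlusUnits (OneSided.S.p1 K))).comap
          (OneSided.S.glEquiv K).toMonoidHom).Normal) := by
  refine ⟨fun u => ⟨_, OneSided.S.det_etaUnit b u⟩, fun a _ _ _ _ _ u => ⟨?_, ?_⟩,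
    fun a u => ⟨?_, ?_⟩, ⟨?_, ?_⟩, fun N h hN => ⟨?_, ?_⟩⟩
  · exact OneSided.S.onePlusUnits_F2_normal.conj_mem _ u.2 _
  · exact OneSided.S.det_conj b _ _ _ rfl
  · exact OneSided.S.onePlusUnits_F2_normal.conj_mem _ u.2 _
  · exact OneSided.S.det_conj b _ _ _ rfl
  · exact (OneSided.S.SL_le b).trans OneSided.S.onePlusUnits_F2_le_p1
  -- This is the smallest intermediate subgroup, $N=\mathrm{SL}$.
  · exact OneSided.S.normal_comap_glEquiv
      (OneSided.S.normal_of_SL_le b le_rfl (OneSided.S.SL_le b))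
  · exact hN.trans OneSided.S.onePlusUnits_F2_le_p1
  · exact OneSided.S.normal_comap_glEquiv (OneSided.S.normal_of_SL_le b h hN)
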